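/- Let $\Omega=\{-1,1\}$, let $\mathbb{P}$ be the uniform product measure on $\Omega^{\mathbb N}$, and call a function $f:\Omega^{\mathbb N}\to\Omega$ a Boolean function. A set $W\subseteq\mathbb N$ is a *witness set* for $f$ at $\omega$ if for $\mathbb P$-almost every $\tilde\omega$ the following holds: if $\tilde\omega_i=\omega_i$ for all $i\in W$, then $f(\tilde\omega)=f(\omega)$. The function $f$ is *finitary* if $\mathbb P$-almost every $\omega$ has a finite witness set for $f$. A (randomised) *algorithm* $A$ for $f$ looks at bits of $\omega$ one after the other; at each step it decides which bit to look at next, or to stop, as a (measurable) function of the positions and values of the bits seen so far and of auxiliary randomness that is independent of $\omega$. Almost surely it stops after finitely many steps, and then the random set $W(A)$ of bits it has looked at is a witness set for $f$ at $\omega$. The *revealment* of $f$ is $$\delta_f=\inf_A\,\sup_{i\in\mathbb N}\,\mathbb{P}(i\in W(A)),$$ where the infimum runs over all algorithms $A$ for $f$, and the probability is over both $\omega$ and the auxiliary randomness. For $\varepsilon\in(0,1]$ and $\omega$ distributed according to $\mathbb P$, let $\omega^\varepsilon$ be obtained from $\omega$ by rerandomising each bit independently with probability $\varepsilon$: $\omega^\varepsilon_i=X_i\omega_i+(1-X_i)\tilde\omega_i$,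 where $\tilde\omega$ has law $\mathbb P$, the $X_i$ are i.i.d. with $\mathbb P(X_i=1)=1-\varepsilon$ and $\mathbb P(X_i=0)=\varepsilon$, and $\omega$, $\tilde\omega$, $(X_i)_i$ are independent. A sequence $(f_n)$ of Boolean functions is *noise sensitive* if for every $\varepsilon\in(0,1]$ $$\lim_{n\to\infty}\Big(\mathbb E\big[f_n(\omega)f_n(\omega^\varepsilon)\big]-\mathbb E\big[f_n(\omega)\big]^2\Big)=0 .$$ **Statement.** If $(f_n)$ is a sequence of finitary Boolean functions with $\delta_{f_n}\to0$, then $(f_n)$ is noise sensitive. -/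

import Mathlib

open MeasureTheory ProbabilityTheory Filter Topology
open scoped ENNReal

noncomputable section

namespace BooleanNoise

/-- A configuration of bits, that is, a point of `{-1, 1}^ℕ`; the bit set `{-1, 1}` is `ℤˣ`. -/
abbrev Cube : Type := ℕ → ℤˣ

/-- A (not necessarily measurable) Boolean function of infinitely many bits. -/
abbrev BoolFun : Type := Cube → ℤˣ

/-- The uniform probability measure on one bit. -/
def bitMeasure : Measure ℤˣ := (PMF.uniformOfFintype ℤˣ).toMeasure

instance : IsProbabilityMeasure bitMeasure := by
  unfold bitMeasure; infer_instance

/-- The uniform probability measure on `{-1, 1}^ℕ`: the bits are independent and uniform. -/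
def cubeMeasure : Measure Cube := Measure.infinitePi fun _ : ℕ => bitMeasure

instance : IsProbabilityMeasure cubeMeasure := by
  unfold cubeMeasure; infer_instance

/-- `W` is a witness set for `f` at `ω`: almost surely, an input that agrees with `ω` on `W`
has the same value of `f` as `ω`. -/
def IsWitness (f : BoolFun) (ω : Cube) (W : Set ℕ) : Prop :=
  ∀ᵐ ω' ∂cubeMeasure, (∀ i ∈ W, ω' i = ω i) → f ω' = f ω

/-- A Boolean function is finitary if almost every input has a finite witness set.
Such a function is automatically almost everywhere measurable. -/
def IsFinitary (f : BoolFun) : Prop :=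
  ∀ᵐ ω ∂cubeMeasure, ∃ W : Finset ℕ, IsWitness f ω (W : Set ℕ)

/-! ### Noise -/

/-- The law of the selectors `X₁, X₂, …`: they are independent, and each is `true` (keep the bit)
with probability `1 - ε` and `false` (rerandomise the bit) with probability `ε`. -/
def selectorMeasure (ε : unitInterval) : Measure (ℕ → Bool) :=
  Measure.infinitePi fun _ : ℕ => bernoulliMeasure true false (unitInterval.symm ε)

/-- The noised configuration: `ω i` where the selector is `true`, and the fresh bit `ω' i`
where it is `false`. -/
def noised (ω ω' : Cube) (X : ℕ → Bool) : Cube := fun i => if X i then ω i else ω' i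

/-- `E[f(ω)]`. -/
def mean (f : BoolFun) : ℝ := ∫ ω, ((f ω : ℤ) : ℝ) ∂cubeMeasure

/-- `E[f(ω) f(ω^ε)]`, where the configuration `ω`, the fresh bits and the selectors are
independent. -/
def noiseCorrelation (f : BoolFun) (ε : unitInterval) : ℝ :=
  ∫ p : Cube × Cube × (ℕ → Bool), ((f p.1 : ℤ) : ℝ) * ((f (noised p.1 p.2.1 p.2.2) : ℤ) : ℝ)
    ∂(cubeMeasure.prod (cubeMeasure.prod (selectorMeasure ε)))

/-- A sequence of Boolean functions is noise sensitive if
`E[f_n(ω) f_n(ω^ε)] - E[f_n(ω)]² → 0` for every noise level `ε > 0`. -/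
def NoiseSensitive (f : ℕ → BoolFun) : Prop :=
  ∀ ε : unitInterval, 0 < ε →
    Tendsto (fun n => noiseCorrelation (f n) ε - mean (f n) ^ 2) atTop (𝓝 0)

/-! ### Randomised algorithms and revealment -/

/-- A randomised query strategy. The auxiliary randomness `θ` is a point of the probability
space `(Seed, seedMeasure)`. Given `θ` and the history so far (the list of the queried bits with
the answers, in the order of the queries), the strategy either names the next bit to look at or
stops (`none`). -/
structure RandomisedStrategy where
  /-- the space of auxiliary randomness -/
  Seed : Type
  [seedSpace : MeasurableSpace Seed]
  /-- the law of the auxiliary randomness -/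
  seedMeasure : Measure Seed
  [seedProb : IsProbabilityMeasure seedMeasure]
  /-- the next bit to look at, or `none` to stop -/
  next : Seed → List (ℕ × ℤˣ) → Option ℕ
  measurableSet_next : ∀ (h : List (ℕ × ℤˣ)) (o : Option ℕ), MeasurableSet {θ | next θ h = o}

attribute [instance] RandomisedStrategy.seedSpace RandomisedStrategy.seedProb

namespace RandomisedStrategy

variable (A : RandomisedStrategy)

/-- The history after `k` steps on the input `ω` with the auxiliary randomness `θ`; it no longer
changes once the strategy has stopped. -/
def history (ω : Cube) (θ : A.Seed) : ℕ → List (ℕ × ℤˣ)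
  | 0 => []
  | k + 1 =>
    match A.next θ (history ω θ k) with
    | none => history ω θ k
    | some i => history ω θ k ++ [(i, ω i)]

/-- The strategy stops after finitely many queries. -/
def Halts (ω : Cube) (θ : A.Seed) : Prop := ∃ k, A.next θ (A.history ω θ k) = none

/-- `W(A)(ω, θ)`, the set of the bits that the strategy looks at. -/
def queried (ω : Cube) (θ : A.Seed) : Set ℕ := {i | ∃ k, A.next θ (A.history ω θ k) = some i}

/-- The joint law of the input and the auxiliary randomness, which are independent. -/
def jointMeasure : Measure (Cube × A.Seed) := cubeMeasure.prod A.seedMeasure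

/-- The strategy is an algorithm for `f`: almost surely it stops after finitely many queries, and
the bits it has looked at determine the value of `f`. -/
def IsAlgorithmFor (f : BoolFun) : Prop :=
  ∀ᵐ p ∂A.jointMeasure, A.Halts p.1 p.2 ∧ IsWitness f p.1 (A.queried p.1 p.2)

/-- The revealment of the algorithm on the bit `i`. -/
def revealmentOn (i : ℕ) : ℝ≥0∞ := A.jointMeasure {p | i ∈ A.queried p.1 p.2}

/-- The revealment of the algorithm. -/
def revealment : ℝ≥0∞ := ⨆ i, A.revealmentOn i

end RandomisedStrategy

/-- The revealment `δ_f` of `f`: the infimum of the revealments of all algorithms for `f`. -/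
def revealment (f : BoolFun) : ℝ≥0∞ :=
  ⨅ (A : RandomisedStrategy) (_ : A.IsAlgorithmFor f), A.revealment

end BooleanNoise

end

/-!
# Low revealment implies noise sensitivity

The proof follows Schramm and Steif. Let `χ_S` be the Walsh characters of the cube. If `f` is
computed by an algorithm of revealment `δ`, and `g = ∑ a_S χ_S` is a finite combination of
characters of one and the same degree `k ≥ 1`, then `E[f g]² ≤ k δ ∑ a_S²`
(`RandomisedStrategy.IsAlgorithmFor.sq_integral_mul_sum_walsh_le`).

To see this, fix the auxiliary randomness and let `W` be the random set of revealed bits. Negating a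
bit outside `W` changes neither `W` nor `f`, but negates the characters that contain this bit, and
it preserves the measure. Hence `E[f χ_S 1[S ∩ W = ∅]] = 0`, so that in `E[f g]` one may replace `g`
by `g' = ∑ a_S 1[S ∩ W ≠ ∅] χ_S`. The summands of `g'` are orthogonal for the same reason: distinct
sets of equal size both contain a bit that is missing from the other. By Cauchy–Schwarz
`E[f g]² ≤ E[g'²] = ∑ a_S² P(S ∩ W ≠ ∅)`, and averaging over the auxiliary randomness bounds the
probabilities by `k δ`.

A finitary `f` is the almost sure limit of functions `p_n` of the first `n` bits (`approx`). For
`p_n = ∑ a_S χ_S` one has `E[p_n(ω) p_n(ω^ε)] - E[p_n]² = ∑_{S ≠ ∅} (1 - ε)^|S| a_S²`. The degrees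
above `K` contribute at most `(1 - ε)^K` by Parseval, and the weight on a degree `k ≤ K` is bounded
by testing `f` against the degree `k` part of `p_n`, up to a multiple of `E[(p_n - f)²]`
(`sum_sq_coeff_le`). Letting `n → ∞` gives the bound `∑_{k ≤ K} 2 k δ + (1 - ε)^K` on the covariance
of `f(ω)` and `f(ω^ε)` (`noiseCorrelation_sub_le_of_revealment`); it is small once `K` is large and
then `δ` is small.
-/

noncomputable section

namespace BooleanNoise

/-! ### Walsh characters and bit flips -/

instance : DiscreteMeasurableSpace ℤˣ where
  forall_measurableSet s := ⟨Units.val '' s, trivial, Set.preimage_image_eq s Units.val_injective⟩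

/-- The Walsh character `χ_S(ω) = ∏_{i ∈ S} ω_i`. -/
def walsh (S : Finset ℕ) (ω : Cube) : ℝ := ∏ i ∈ S, ((ω i : ℤ) : ℝ)

/-- The configuration `ω` with the bit `i` negated. -/
def flip (i : ℕ) (ω : Cube) : Cube := Function.update ω i (-ω i)

lemma flip_self (i : ℕ) (ω : Cube) : flip i ω i = -ω i := by simp [flip]

lemma flip_of_ne {i j : ℕ} (h : j ≠ i) (ω : Cube) : flip i ω j = ω j := by simp [flip, h]

lemma flip_involutive (i : ℕ) : Function.Involutive (flip i) := by
  intro ω; simp [flip]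

lemma measurable_flip (i : ℕ) : Measurable (flip i) := by
  unfold flip
  refine measurable_pi_lambda _ fun j => ?_
  by_cases h : j = i
  · subst h
    have hneg : Measurable fun u : ℤˣ => -u := .of_discrete
    simp only [Function.update_self]
    exact hneg.comp (measurable_pi_apply (X := fun _ => ℤˣ) j)
  · simpa [h] using measurable_pi_apply j

lemma sq_units_real (u : ℤˣ) : ((u : ℤ) : ℝ) ^ 2 = 1 := by
  rcases Int.units_eq_one_or u with rfl | rfl <;> simp

lemma abs_units_real (u : ℤˣ) : |((u : ℤ) : ℝ)| = 1 := by
  rcases Int.units_eq_one_or u with rfl | rfl <;> simp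

lemma measurable_units_real : Measurable fun u : ℤˣ => ((u : ℤ) : ℝ) := .of_discrete

@[simp] lemma walsh_empty (ω : Cube) : walsh ∅ ω = 1 := by simp [walsh]

lemma measurable_walsh (S : Finset ℕ) : Measurable (walsh S) :=
  Finset.measurable_prod _ fun i _ => measurable_units_real.comp (measurable_pi_apply i)

lemma walsh_mul_self (S : Finset ℕ) (ω : Cube) : walsh S ω * walsh S ω = 1 := by
  rw [walsh, ← Finset.prod_mul_distrib]
  exact Finset.prod_eq_one fun i _ => by rw [← sq, sq_units_real]

lemma abs_walsh (S : Finset ℕ) (ω : Cube) : |walsh S ω| = 1 := by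
  rw [walsh, Finset.abs_prod]
  exact Finset.prod_eq_one fun i _ => abs_units_real _

lemma walsh_congr {S : Finset ℕ} {ω ω' : Cube} (h : ∀ i ∈ S, ω i = ω' i) :
    walsh S ω = walsh S ω' :=
  Finset.prod_congr rfl fun i hi => by rw [h i hi]

lemma walsh_flip_of_notMem {S : Finset ℕ} {i : ℕ} (h : i ∉ S) (ω : Cube) :
    walsh S (flip i ω) = walsh S ω :=
  walsh_congr fun _ hj => flip_of_ne (ne_of_mem_of_not_mem hj h) ω

lemma walsh_insert {S : Finset ℕ} {i : ℕ} (h : i ∉ S) (ω : Cube) :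
    walsh (insert i S) ω = ((ω i : ℤ) : ℝ) * walsh S ω := Finset.prod_insert h

lemma walsh_flip_of_mem {S : Finset ℕ} {i : ℕ} (h : i ∈ S) (ω : Cube) :
    walsh S (flip i ω) = -walsh S ω := by
  rw [← Finset.insert_erase h, walsh_insert (Finset.notMem_erase i S),
    walsh_insert (Finset.notMem_erase i S), walsh_flip_of_notMem (Finset.notMem_erase i S),
    flip_self]
  push_cast
  ring

lemma bitMeasure_map_neg : bitMeasure.map (fun u => -u) = bitMeasure := by
  refine Measure.ext_of_singleton fun u => ?_
  have key : ∀ u : ℤˣ, bitMeasure {u} = (2 : ℝ≥0∞)⁻¹ := fun u => by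
    rw [bitMeasure, PMF.toMeasure_apply_singleton _ _ (MeasurableSet.of_discrete)]
    simp
  rw [Measure.map_apply .of_discrete (MeasurableSet.of_discrete)]
  have : (fun v : ℤˣ => -v) ⁻¹' {u} = {-u} := by
    ext v; simp
  rw [this, key, key]

lemma measurePreserving_flip (i : ℕ) : MeasurePreserving (flip i) cubeMeasure cubeMeasure := by
  refine ⟨measurable_flip i, ?_⟩
  have h := Measure.infinitePi_map_pi (X := fun _ : ℕ => ℤˣ) (Y := fun _ => ℤˣ)
    (fun _ : ℕ => bitMeasure)
    (f := fun j u => if j = i then -u else u) (fun _ => .of_discrete)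
  have e1 : (fun (x : Cube) j => if j = i then -x j else x j) = flip i := by
    funext x j
    by_cases h : j = i
    · subst h; simp [flip]
    · simp [flip, h]
  have e2 : (fun j : ℕ => bitMeasure.map (fun u => if j = i then -u else u))
      = fun _ => bitMeasure := by
    funext j
    by_cases h : j = i
    · simp [h, bitMeasure_map_neg]
    · simp [h]
  rw [e1] at h
  unfold cubeMeasure
  rw [h]
  congr 1

/-- A function negated by a measure preserving involution has integral zero. Every cancellation
between Walsh characters is obtained from this, with a bit flip as the involution. -/
lemma integral_eq_zero_of_comp_eq_neg {α : Type*} [MeasurableSpace α] {μ : Measure α} {T : α → α}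
    (hT : MeasurePreserving T μ μ) (hinv : Function.Involutive T) {h : α → ℝ}
    (hh : ∀ᵐ x ∂μ, h (T x) = -h x) : ∫ x, h x ∂μ = 0 := by
  have h1 := hT.integral_comp
    (MeasurableEquiv.ofInvolutive T hinv hT.measurable).measurableEmbedding h
  rw [integral_congr_ae hh, integral_neg] at h1
  linarith

lemma integral_eq_zero_of_flip (i : ℕ) {h : Cube → ℝ}
    (hh : ∀ᵐ ω ∂cubeMeasure, h (flip i ω) = -h ω) : ∫ ω, h ω ∂cubeMeasure = 0 :=
  integral_eq_zero_of_comp_eq_neg (measurePreserving_flip i) (flip_involutive i) hh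

lemma integrable_walsh (S : Finset ℕ) : Integrable (walsh S) cubeMeasure :=
  Integrable.of_bound (measurable_walsh S).aestronglyMeasurable 1
    (ae_of_all _ fun ω => by rw [Real.norm_eq_abs, abs_walsh])

lemma integrable_walsh_mul (S T : Finset ℕ) :
    Integrable (fun ω => walsh S ω * walsh T ω) cubeMeasure :=
  Integrable.of_bound ((measurable_walsh S).mul (measurable_walsh T)).aestronglyMeasurable 1
    (ae_of_all _ fun ω => by rw [Real.norm_eq_abs, abs_mul, abs_walsh, abs_walsh, one_mul])

lemma exists_mem_xor {S T : Finset ℕ} (h : S ≠ T) : ∃ i, (i ∈ S ∧ i ∉ T) ∨ (i ∈ T ∧ i ∉ S) := by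
  by_contra! H
  exact h (Finset.ext fun i => ⟨fun hi => (H i).1 hi, fun hi => (H i).2 hi⟩)

lemma integral_walsh_mul (S T : Finset ℕ) :
    ∫ ω, walsh S ω * walsh T ω ∂cubeMeasure = if S = T then 1 else 0 := by
  split_ifs with h
  · subst h; simp [walsh_mul_self]
  · obtain ⟨i, ⟨hS, hT⟩ | ⟨hT, hS⟩⟩ := exists_mem_xor h <;>
    · refine integral_eq_zero_of_flip i (ae_of_all _ fun ω => ?_)
      simp [walsh_flip_of_mem, walsh_flip_of_notMem, hS, hT]

/-- Orthonormality of the Walsh characters, for finite linear combinations. -/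
lemma integral_sum_walsh_mul_sum_walsh (𝒮 𝒯 : Finset (Finset ℕ)) (h𝒯 : 𝒯 ⊆ 𝒮)
    (a : Finset ℕ → ℝ) :
    ∫ ω, (∑ S ∈ 𝒮, a S * walsh S ω) * (∑ T ∈ 𝒯, a T * walsh T ω) ∂cubeMeasure
      = ∑ T ∈ 𝒯, a T ^ 2 := by
  have h1 : ∀ ω, (∑ S ∈ 𝒮, a S * walsh S ω) * (∑ T ∈ 𝒯, a T * walsh T ω)
      = ∑ T ∈ 𝒯, ∑ S ∈ 𝒮, (a S * a T) * (walsh S ω * walsh T ω) := fun ω => by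
    rw [Finset.sum_mul_sum, Finset.sum_comm]
    exact Finset.sum_congr rfl fun _ _ => Finset.sum_congr rfl fun _ _ => by ring
  simp_rw [h1]
  rw [integral_finsetSum _ fun T _ => integrable_finsetSum _ fun S _ =>
    (integrable_walsh_mul S T).const_mul _]
  refine Finset.sum_congr rfl fun T hT => ?_
  rw [integral_finsetSum _ fun S _ => (integrable_walsh_mul S T).const_mul _]
  simp_rw [integral_const_mul, integral_walsh_mul]
  simp [h𝒯 hT, sq]

/-- The Cauchy–Schwarz inequality. -/
lemma sq_integral_mul_le {α : Type*} [MeasurableSpace α] {μ : Measure α} {u v : α → ℝ}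
    (hu : Integrable (fun x => u x ^ 2) μ) (hv : Integrable (fun x => v x ^ 2) μ)
    (huv : Integrable (fun x => u x * v x) μ) :
    (∫ x, u x * v x ∂μ) ^ 2 ≤ (∫ x, u x ^ 2 ∂μ) * ∫ x, v x ^ 2 ∂μ := by
  have h : ∀ t : ℝ, 0 ≤ (∫ x, v x ^ 2 ∂μ) * (t * t) + (-2 * ∫ x, u x * v x ∂μ) * t
      + ∫ x, u x ^ 2 ∂μ := fun t => by
    have h0 : 0 ≤ ∫ x, (u x - t * v x) ^ 2 ∂μ := integral_nonneg fun x => sq_nonneg _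
    have h1 : ∀ x, (u x - t * v x) ^ 2 = (t * t) * v x ^ 2 + ((-2 * t) * (u x * v x) + u x ^ 2) :=
      fun x => by ring
    simp_rw [h1] at h0
    have huvu : Integrable (fun x => (-2 * t) * (u x * v x) + u x ^ 2) μ := (huv.const_mul _).add hu
    rw [integral_add (hv.const_mul _) huvu,
      integral_add (huv.const_mul _) hu, integral_const_mul, integral_const_mul] at h0
    linarith
  have := discrim_le_zero h
  rw [discrim] at this
  nlinarith

/-! ### The level inequality for a set of revealed bits -/

section Revealed

variable (W : Cube → Set ℕ)

open Classical in
/-- The indicator of the event that the revealed set `W` misses `S` altogether. -/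
def missed (S : Finset ℕ) (ω : Cube) : ℝ := if ∀ i ∈ S, i ∉ W ω then 1 else 0

variable {W}

lemma missed_mul_self (S : Finset ℕ) (ω : Cube) :
    missed W S ω * missed W S ω = missed W S ω := by
  unfold missed; split_ifs <;> simp

lemma abs_missed_le (S : Finset ℕ) (ω : Cube) : |missed W S ω| ≤ 1 := by
  unfold missed; split_ifs <;> simp

lemma measurableSet_missed (hW : ∀ i, MeasurableSet {ω | i ∈ W ω}) (S : Finset ℕ) :
    MeasurableSet {ω | ∀ i ∈ S, i ∉ W ω} := by
  have : {ω | ∀ i ∈ S, i ∉ W ω} = ⋂ i ∈ S, {ω | i ∈ W ω}ᶜ := by ext; simp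
  rw [this]
  exact Finset.measurableSet_biInter _ fun i _ => (hW i).compl

lemma measurable_missed (hW : ∀ i, MeasurableSet {ω | i ∈ W ω}) (S : Finset ℕ) :
    Measurable (missed W S) :=
  Measurable.ite (measurableSet_missed hW S) measurable_const measurable_const

lemma missed_flip (hflip : ∀ ω i, i ∉ W ω → W (flip i ω) = W ω) {S : Finset ℕ} {i : ℕ}
    (hi : i ∈ S) (ω : Cube) : missed W S (flip i ω) = missed W S ω := by
  by_cases h : i ∈ W ω
  · have h' : i ∈ W (flip i ω) := by
      by_contra h'
      have := hflip _ _ h'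
      rw [flip_involutive i ω] at this
      exact h' (this ▸ h)
    unfold missed
    rw [if_neg fun H => H i hi h', if_neg fun H => H i hi h]
  · unfold missed
    rw [hflip ω i h]

lemma notMem_of_missed_ne_zero {S : Finset ℕ} {i : ℕ} (hi : i ∈ S) {ω : Cube}
    (h : missed W S ω ≠ 0) : i ∉ W ω := by
  unfold missed at h
  by_contra hW
  exact h (if_neg fun H => H i hi hW)

lemma missed_mul_missed_flip (hflip : ∀ ω i, i ∉ W ω → W (flip i ω) = W ω) {S : Finset ℕ} {i : ℕ}
    (hi : i ∈ S) (T : Finset ℕ) (ω : Cube) :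
    missed W S (flip i ω) * missed W T (flip i ω) = missed W S ω * missed W T ω := by
  rw [missed_flip hflip hi]
  by_cases h : missed W S ω = 0
  · simp [h]
  · have : missed W T (flip i ω) = missed W T ω := by
      unfold missed
      rw [hflip ω i (notMem_of_missed_ne_zero hi h)]
    rw [this]

/-- The functions `1[S ∩ W ≠ ∅] χ_S`, with `S` of a fixed size, are orthogonal. -/
lemma integral_hit_walsh_mul (hW : ∀ i, MeasurableSet {ω | i ∈ W ω})
    (hflip : ∀ ω i, i ∉ W ω → W (flip i ω) = W ω) {S T : Finset ℕ} (hcard : S.card = T.card) :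
    ∫ ω, ((1 - missed W S ω) * walsh S ω) * ((1 - missed W T ω) * walsh T ω) ∂cubeMeasure
      = if S = T then cubeMeasure.real {ω | ∃ i ∈ S, i ∈ W ω} else 0 := by
  split_ifs with h
  · subst h
    have h1 : ∀ ω, ((1 - missed W S ω) * walsh S ω) * ((1 - missed W S ω) * walsh S ω)
        = Set.indicator {ω | ∃ i ∈ S, i ∈ W ω} 1 ω := fun ω => by
      have h2 : ((1 - missed W S ω) * walsh S ω) * ((1 - missed W S ω) * walsh S ω)
          = 1 - missed W S ω := by
        linear_combination (1 - missed W S ω) ^ 2 * walsh_mul_self S ω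
          + missed_mul_self (W := W) S ω
      rw [h2]
      by_cases h3 : ∃ i ∈ S, i ∈ W ω
      · have h4 : ¬ ∀ i ∈ S, i ∉ W ω := by push Not; exact h3
        rw [Set.indicator_of_mem (show ω ∈ {ω | ∃ i ∈ S, i ∈ W ω} from h3), missed, if_neg h4]
        simp
      · have h4 : ∀ i ∈ S, i ∉ W ω := by push Not at h3; exact h3
        rw [Set.indicator_of_notMem (show ω ∉ {ω | ∃ i ∈ S, i ∈ W ω} from h3), missed, if_pos h4]
        simp
    simp_rw [h1]
    rw [integral_indicator_one]
    convert (measurableSet_missed hW S).compl using 1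
    ext ω; simp
  -- After expansion of `(1 - 1[S ∩ W = ∅]) (1 - 1[T ∩ W = ∅])`, each of the four terms is negated
  -- by the flip of a bit `i ∈ S \ T` or `j ∈ T \ S`, chosen such that the indicator in the term,
  -- if there is one, vanishes where that bit is revealed, and hence is invariant under the flip.
  · obtain ⟨i, hiS, hiT⟩ :=
      Finset.not_subset.1 fun hs => h (Finset.eq_of_subset_of_card_le hs hcard.ge)
    obtain ⟨j, hjT, hjS⟩ :=
      Finset.not_subset.1 fun hs => h (Finset.eq_of_subset_of_card_le hs hcard.le).symm
    have z1 : ∫ ω, walsh S ω * walsh T ω ∂cubeMeasure = 0 := by rw [integral_walsh_mul, if_neg h]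
    have z2 : ∫ ω, missed W S ω * (walsh S ω * walsh T ω) ∂cubeMeasure = 0 := by
      refine integral_eq_zero_of_flip i (ae_of_all _ fun ω => ?_)
      rw [missed_flip hflip hiS, walsh_flip_of_mem hiS, walsh_flip_of_notMem hiT]
      ring
    have z3 : ∫ ω, missed W T ω * (walsh S ω * walsh T ω) ∂cubeMeasure = 0 := by
      refine integral_eq_zero_of_flip j (ae_of_all _ fun ω => ?_)
      rw [missed_flip hflip hjT, walsh_flip_of_mem hjT, walsh_flip_of_notMem hjS]
      ring
    have z4 : ∫ ω, (missed W S ω * missed W T ω) * (walsh S ω * walsh T ω) ∂cubeMeasure = 0 := by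
      refine integral_eq_zero_of_flip i (ae_of_all _ fun ω => ?_)
      rw [missed_mul_missed_flip hflip hiS, walsh_flip_of_mem hiS, walsh_flip_of_notMem hiT]
      ring
    have hS := measurable_missed hW S
    have hT := measurable_missed hW T
    have i1 := integrable_walsh_mul S T
    have i2 : Integrable (fun ω => missed W S ω * (walsh S ω * walsh T ω)) cubeMeasure :=
      i1.bdd_mul hS.aestronglyMeasurable (ae_of_all _ (abs_missed_le S))
    have i3 : Integrable (fun ω => missed W T ω * (walsh S ω * walsh T ω)) cubeMeasure :=
      i1.bdd_mul hT.aestronglyMeasurable (ae_of_all _ (abs_missed_le T))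
    have i4 : Integrable (fun ω => (missed W S ω * missed W T ω) * (walsh S ω * walsh T ω))
        cubeMeasure := by
      simp_rw [mul_assoc (missed W S _)]
      exact i3.bdd_mul hS.aestronglyMeasurable (ae_of_all _ (abs_missed_le S))
    have e : ∀ ω, ((1 - missed W S ω) * walsh S ω) * ((1 - missed W T ω) * walsh T ω)
        = (walsh S ω * walsh T ω - missed W S ω * (walsh S ω * walsh T ω))
          - (missed W T ω * (walsh S ω * walsh T ω)
            - (missed W S ω * missed W T ω) * (walsh S ω * walsh T ω)) := fun ω => by ring
    have i12 : Integrable (fun ω => walsh S ω * walsh T ω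
        - missed W S ω * (walsh S ω * walsh T ω)) cubeMeasure := i1.sub i2
    have i34 : Integrable (fun ω => missed W T ω * (walsh S ω * walsh T ω)
        - (missed W S ω * missed W T ω) * (walsh S ω * walsh T ω)) cubeMeasure := i3.sub i4
    simp_rw [e]
    rw [integral_sub i12 i34, integral_sub i1 i2, integral_sub i3 i4, z1, z2, z3, z4]
    simp

/-- If the bits in `W` are revealed and determine `f`, then the correlation of `f` with a
homogeneous Walsh polynomial `∑ a_S χ_S` is governed by those `S` that `W` meets. The hypothesis
`hflip` says that `W` is found by a query procedure: a bit outside `W` has no influence on `W`. -/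
lemma sq_integral_mul_sum_walsh_le (hW : ∀ i, MeasurableSet {ω | i ∈ W ω})
    (hflip : ∀ ω i, i ∉ W ω → W (flip i ω) = W ω) {f : BoolFun}
    (hfm : AEStronglyMeasurable (fun ω => ((f ω : ℤ) : ℝ)) cubeMeasure)
    (hf : ∀ i, ∀ᵐ ω ∂cubeMeasure, i ∉ W ω → f (flip i ω) = f ω)
    {k : ℕ} (hk : k ≠ 0) {𝒮 : Finset (Finset ℕ)} (h𝒮 : ∀ S ∈ 𝒮, S.card = k) (a : Finset ℕ → ℝ) :
    (∫ ω, ((f ω : ℤ) : ℝ) * ∑ S ∈ 𝒮, a S * walsh S ω ∂cubeMeasure) ^ 2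
      ≤ ∑ S ∈ 𝒮, a S ^ 2 * cubeMeasure.real {ω | ∃ i ∈ S, i ∈ W ω} := by
  set F : Cube → ℝ := fun ω => ((f ω : ℤ) : ℝ) with hF
  set h : Finset ℕ → Cube → ℝ := fun S ω => (1 - missed W S ω) * walsh S ω with hh
  have hm : ∀ S, AEStronglyMeasurable (h S) cubeMeasure := fun S =>
    ((measurable_const.sub (measurable_missed hW S)).mul (measurable_walsh S)).aestronglyMeasurable
  have hb : ∀ S ω, ‖h S ω‖ ≤ 1 := fun S ω => by
    rw [Real.norm_eq_abs, hh, abs_mul, abs_walsh, mul_one, missed]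
    split_ifs <;> simp
  have hi : ∀ S, Integrable (h S) cubeMeasure := fun S => .of_bound (hm S) 1 (ae_of_all _ (hb S))
  have hij : ∀ S T, Integrable (fun ω => h S ω * h T ω) cubeMeasure := fun S T =>
    (hi T).bdd_mul (hm S) (ae_of_all _ (hb S))
  have hFb : ∀ᵐ ω ∂cubeMeasure, ‖F ω‖ ≤ 1 := ae_of_all _ fun ω => (abs_units_real _).le
  have hFh : ∀ S, Integrable (fun ω => F ω * h S ω) cubeMeasure := fun S =>
    (hi S).bdd_mul hfm hFb
  have hFw : ∀ S, Integrable (fun ω => F ω * walsh S ω) cubeMeasure := fun S =>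
    (integrable_walsh S).bdd_mul hfm hFb
  -- A character `χ_S` all of whose bits are unrevealed is invisible to `f`.
  have hFeq : ∀ S ∈ 𝒮, ∫ ω, F ω * walsh S ω ∂cubeMeasure = ∫ ω, F ω * h S ω ∂cubeMeasure := by
    intro S hS
    obtain ⟨i, hiS⟩ : S.Nonempty := Finset.card_pos.1 (by rw [h𝒮 S hS]; omega)
    rw [← sub_eq_zero, ← integral_sub (hFw S) (hFh S)]
    refine integral_eq_zero_of_flip i ?_
    filter_upwards [hf i] with ω hω
    simp only [hh, hF]
    rw [missed_flip hflip hiS, walsh_flip_of_mem hiS]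
    by_cases h0 : missed W S ω = 0
    · simp [h0]
    · rw [hω (notMem_of_missed_ne_zero hiS h0)]
      ring
  have hL : ∫ ω, F ω * ∑ S ∈ 𝒮, a S * walsh S ω ∂cubeMeasure
      = ∫ ω, F ω * ∑ S ∈ 𝒮, a S * h S ω ∂cubeMeasure := by
    simp_rw [Finset.mul_sum, mul_left_comm (F _)]
    rw [integral_finsetSum _ fun S _ => (hFw S).const_mul _,
      integral_finsetSum _ fun S _ => (hFh S).const_mul _]
    simp_rw [integral_const_mul]
    exact Finset.sum_congr rfl fun S hS => by rw [hFeq S hS]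
  have hsq : ∀ ω, (∑ S ∈ 𝒮, a S * h S ω) ^ 2
      = ∑ S ∈ 𝒮, ∑ T ∈ 𝒮, (a S * a T) * (h S ω * h T ω) := fun ω => by
    rw [sq, Finset.sum_mul_sum]
    exact Finset.sum_congr rfl fun _ _ => Finset.sum_congr rfl fun _ _ => by ring
  have hR : ∫ ω, (∑ S ∈ 𝒮, a S * h S ω) ^ 2 ∂cubeMeasure
      = ∑ S ∈ 𝒮, a S ^ 2 * cubeMeasure.real {ω | ∃ i ∈ S, i ∈ W ω} := by
    simp_rw [hsq]
    rw [integral_finsetSum _ fun S _ => integrable_finsetSum _ fun T _ =>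
      (hij S T).const_mul _]
    refine Finset.sum_congr rfl fun S hS => ?_
    rw [integral_finsetSum _ fun T _ => (hij S T).const_mul _]
    simp_rw [integral_const_mul]
    rw [Finset.sum_eq_single S]
    · rw [integral_hit_walsh_mul hW hflip rfl, if_pos rfl, sq]
    · intro T hT hne
      rw [integral_hit_walsh_mul hW hflip ((h𝒮 S hS).trans (h𝒮 T hT).symm), if_neg hne.symm,
        mul_zero]
    · exact fun hn => absurd hS hn
  have hF2 : ∀ ω, F ω ^ 2 = 1 := fun ω => sq_units_real _
  have hcs := sq_integral_mul_le (μ := cubeMeasure) (u := F) (v := fun ω => ∑ S ∈ 𝒮, a S * h S ω)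
    (by simp_rw [hF2]; exact integrable_const _)
    (by
      simp_rw [hsq]
      exact integrable_finsetSum _ fun S _ => integrable_finsetSum _ fun T _ =>
        (hij S T).const_mul _)
    (by
      refine (integrable_finsetSum _ fun S _ => (hi S).const_mul _).bdd_mul hfm hFb)
  rw [hR] at hcs
  simp_rw [hF2] at hcs
  rw [hL]
  simpa using hcs

end Revealed

/-! ### Inputs that share a finite pattern -/

/-- Almost every `ω` is typical for each of its finite patterns: a value that `f` takes almost
everywhere on the cylinder through `ω` is the value of `f` at `ω`. There are only countably many
cylinders, so that no measurability of `f` is needed. -/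
lemma ae_eq_of_ae_cylinder (f : BoolFun) :
    ∀ᵐ ω ∂cubeMeasure, ∀ (W : Finset ℕ) (c : ℤˣ),
      (∀ᵐ ω' ∂cubeMeasure, (∀ i ∈ W, ω' i = ω i) → f ω' = c) → f ω = c := by
  have key : ∀ᵐ ω ∂cubeMeasure, ∀ (W : Finset ℕ) (c : ℤˣ) (x : W → ℤˣ),
      (∀ᵐ ω' ∂cubeMeasure, (∀ i : W, ω' i = x i) → f ω' = c) →
        (∀ i : W, ω i = x i) → f ω = c := by
    refine ae_all_iff.2 fun W => ae_all_iff.2 fun c => ae_all_iff.2 fun x => ?_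
    by_cases h : ∀ᵐ ω' ∂cubeMeasure, (∀ i : W, ω' i = x i) → f ω' = c
    · filter_upwards [h] with ω hω _ using hω
    · exact ae_of_all _ fun ω hω => absurd hω h
  filter_upwards [key] with ω hω W c h
  refine hω W c (fun i => ω i) ?_ fun _ => rfl
  filter_upwards [h] with ω' hω' hag using hω' fun i hi => hag ⟨i, hi⟩

/-- A bit outside a finite witness set almost surely has no influence on `f`. -/
lemma ae_eq_flip_of_isWitness (f : BoolFun) (i : ℕ) :
    ∀ᵐ ω ∂cubeMeasure, ∀ W : Finset ℕ, i ∉ W → IsWitness f ω W → f (flip i ω) = f ω := by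
  filter_upwards [(measurePreserving_flip i).quasiMeasurePreserving.ae (ae_eq_of_ae_cylinder f)]
    with ω hω W hi hW
  refine hω W _ ?_
  filter_upwards [hW] with ω' hω' hag
  refine hω' fun j hj => ?_
  rw [hag j hj, flip_of_ne (ne_of_mem_of_not_mem hj hi)]

/-! ### Query strategies -/

namespace RandomisedStrategy

variable (A : RandomisedStrategy)

lemma history_succ_of_none {ω : Cube} {θ : A.Seed} {k : ℕ}
    (h : A.next θ (A.history ω θ k) = none) : A.history ω θ (k + 1) = A.history ω θ k := by
  rw [history, h]

lemma history_succ_of_some {ω : Cube} {θ : A.Seed} {k i : ℕ}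
    (h : A.next θ (A.history ω θ k) = some i) :
    A.history ω θ (k + 1) = A.history ω θ k ++ [(i, ω i)] := by
  rw [history, h]

lemma history_congr {ω ω' : Cube} {θ : A.Seed} (h : ∀ i ∈ A.queried ω θ, ω' i = ω i) (k : ℕ) :
    A.history ω' θ k = A.history ω θ k := by
  induction k with
  | zero => rfl
  | succ k ih =>
    cases hn : A.next θ (A.history ω θ k) with
    | none => rw [history_succ_of_none A hn, history_succ_of_none A (by rw [ih, hn]), ih]
    | some i =>
      rw [history_succ_of_some A hn, history_succ_of_some A (i := i) (by rw [ih, hn]), ih,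
        h i ⟨k, hn⟩]

lemma queried_flip {ω : Cube} {θ : A.Seed} {i : ℕ} (hi : i ∉ A.queried ω θ) :
    A.queried (flip i ω) θ = A.queried ω θ := by
  have h := A.history_congr (ω' := flip i ω) (ω := ω) (θ := θ)
    fun j hj => flip_of_ne (ne_of_mem_of_not_mem hj hi) ω
  simp only [queried, h]

lemma Halts.finite_queried {A : RandomisedStrategy} {ω : Cube} {θ : A.Seed} (h : A.Halts ω θ) :
    (A.queried ω θ).Finite := by
  obtain ⟨K, hK⟩ := h
  have hconst : ∀ m, A.history ω θ (K + m) = A.history ω θ K := fun m => by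
    induction m with
    | zero => rfl
    | succ m ih => rw [← Nat.add_assoc, history_succ_of_none A (by rw [ih, hK]), ih]
  refine ((Finset.range K).finite_toSet.biUnion
    (t := fun k => {i | A.next θ (A.history ω θ k) = some i}) fun k _ => ?_).subset ?_
  · exact Set.Subsingleton.finite fun i hi j hj => Option.some_injective _ (hi.symm.trans hj)
  · rintro i ⟨k, hk⟩
    rcases lt_or_ge k K with hlt | hge
    · exact Set.mem_biUnion (by simpa using hlt) hk
    · obtain ⟨m, rfl⟩ := Nat.exists_eq_add_of_le hge
      rw [hconst, hK] at hk
      cases hk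

lemma measurableSet_history (θ : A.Seed) (k : ℕ) (s : Set (List (ℕ × ℤˣ))) :
    MeasurableSet {ω | A.history ω θ k ∈ s} := by
  induction k generalizing s with
  | zero => exact MeasurableSet.const ([] ∈ s)
  | succ k ih =>
    have e : {ω | A.history ω θ (k + 1) ∈ s}
        = ⋃ h : List (ℕ × ℤˣ), {ω | A.history ω θ k ∈ ({h} : Set _)} ∩
          {ω | (match A.next θ h with
            | none => h
            | some i => h ++ [(i, ω i)]) ∈ s} := by
      ext ω
      simp only [history, Set.mem_ofPred_eq, Set.mem_iUnion, Set.mem_inter_iff,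
        Set.mem_singleton_iff, exists_eq_left']
    rw [e]
    refine MeasurableSet.iUnion fun h => (ih {h}).inter ?_
    cases A.next θ h with
    | none => exact MeasurableSet.const (h ∈ s)
    | some i =>
      exact measurable_pi_apply i (MeasurableSet.of_discrete (s := {u | h ++ [(i, u)] ∈ s}))

lemma measurableSet_queried (θ : A.Seed) (i : ℕ) : MeasurableSet {ω | i ∈ A.queried ω θ} := by
  have e : {ω | i ∈ A.queried ω θ}
      = ⋃ k, {ω | A.history ω θ k ∈ {h | A.next θ h = some i}} := by
    ext ω; simp [queried]
  rw [e]
  exact MeasurableSet.iUnion fun k => A.measurableSet_history θ k _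

variable {A}

/-- For almost every seed, an algorithm is a deterministic query procedure whose revealed bits
determine `f`. -/
lemma IsAlgorithmFor.ae_flip {f : BoolFun} (hA : A.IsAlgorithmFor f) :
    ∀ᵐ θ ∂A.seedMeasure, ∀ i, ∀ᵐ ω ∂cubeMeasure,
      i ∉ A.queried ω θ → f (flip i ω) = f ω := by
  have h1 : ∀ᵐ q ∂A.seedMeasure.prod cubeMeasure,
      A.Halts q.2 q.1 ∧ IsWitness f q.2 (A.queried q.2 q.1) :=
    (Measure.measurePreserving_swap (μ := A.seedMeasure)
      (ν := cubeMeasure)).quasiMeasurePreserving.ae hA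
  filter_upwards [Measure.ae_ae_of_ae_prod h1] with θ hθ i
  filter_upwards [hθ, ae_eq_flip_of_isWitness f i] with ω hω hfl hi
  refine hfl hω.1.finite_queried.toFinset (by simpa using hi) ?_
  rw [Set.Finite.coe_toFinset]
  exact hω.2

/-- The Schramm–Steif inequality in dual form: a Boolean function computed by an algorithm of
revealment `δ` has squared correlation at most `k δ` with any normalised homogeneous Walsh
polynomial of degree `k`. -/
theorem IsAlgorithmFor.sq_integral_mul_sum_walsh_le {f : BoolFun} (hA : A.IsAlgorithmFor f)
    (hfm : AEStronglyMeasurable (fun ω => ((f ω : ℤ) : ℝ)) cubeMeasure) {δ : ℝ} (hδ : 0 ≤ δ)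
    (hAδ : A.revealment ≤ ENNReal.ofReal δ)
    {k : ℕ} (hk : k ≠ 0) {𝒮 : Finset (Finset ℕ)} (h𝒮 : ∀ S ∈ 𝒮, S.card = k) (a : Finset ℕ → ℝ) :
    (∫ ω, ((f ω : ℤ) : ℝ) * ∑ S ∈ 𝒮, a S * walsh S ω ∂cubeMeasure) ^ 2
      ≤ k * δ * ∑ S ∈ 𝒮, a S ^ 2 := by
  set c := (∫ ω, ((f ω : ℤ) : ℝ) * ∑ S ∈ 𝒮, a S * walsh S ω ∂cubeMeasure) ^ 2
  -- Measurable hulls of the events `i ∈ W(A)` spare the joint measurability of the strategy.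
  set t : ℕ → Set (A.Seed × Cube) := fun i =>
    toMeasurable (A.seedMeasure.prod cubeMeasure) {q | i ∈ A.queried q.2 q.1}
  have htm : ∀ i, MeasurableSet (t i) := fun i => measurableSet_toMeasurable _ _
  have ht : ∀ i, A.seedMeasure.prod cubeMeasure (t i) ≤ ENNReal.ofReal δ := fun i => by
    rw [measure_toMeasurable]
    refine le_trans (le_of_eq ?_) ((le_iSup A.revealmentOn i).trans hAδ)
    have hsw := (Measure.measurePreserving_swap (μ := A.seedMeasure) (ν := cubeMeasure))
    exact hsw.measure_preimage_equiv (f := MeasurableEquiv.prodComm)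
      {p : Cube × A.Seed | i ∈ A.queried p.1 p.2}
  have hmain : ∀ᵐ θ ∂A.seedMeasure, ENNReal.ofReal c
      ≤ ∑ S ∈ 𝒮, ENNReal.ofReal (a S ^ 2) * ∑ i ∈ S, cubeMeasure (Prod.mk θ ⁻¹' t i) := by
    filter_upwards [hA.ae_flip] with θ hθ
    have h1 := BooleanNoise.sq_integral_mul_sum_walsh_le (W := fun ω => A.queried ω θ)
      (A.measurableSet_queried θ) (fun ω i hi => A.queried_flip hi) hfm hθ hk h𝒮 a
    refine (ENNReal.ofReal_le_ofReal h1).trans ?_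
    rw [ENNReal.ofReal_sum_of_nonneg fun S _ => by positivity]
    refine Finset.sum_le_sum fun S _ => ?_
    rw [ENNReal.ofReal_mul (sq_nonneg _), ofReal_measureReal]
    gcongr
    have h2 : {ω | ∃ i ∈ S, i ∈ A.queried ω θ} ⊆ ⋃ i ∈ S, Prod.mk θ ⁻¹' t i := by
      rintro ω ⟨i, hi, hq⟩
      exact Set.mem_biUnion hi
        (subset_toMeasurable _ {q : A.Seed × Cube | i ∈ A.queried q.2 q.1} hq)
    exact (measure_mono h2).trans (measure_biUnion_finset_le _ _)
  have hint : ENNReal.ofReal c ≤ ENNReal.ofReal (k * δ * ∑ S ∈ 𝒮, a S ^ 2) := by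
    calc ENNReal.ofReal c = ∫⁻ _, ENNReal.ofReal c ∂A.seedMeasure := by simp
      _ ≤ ∫⁻ θ, ∑ S ∈ 𝒮, ENNReal.ofReal (a S ^ 2) *
            ∑ i ∈ S, cubeMeasure (Prod.mk θ ⁻¹' t i) ∂A.seedMeasure := lintegral_mono_ae hmain
      _ = ∑ S ∈ 𝒮, ENNReal.ofReal (a S ^ 2) *
            ∑ i ∈ S, A.seedMeasure.prod cubeMeasure (t i) := by
          have hm : ∀ i, Measurable fun θ => cubeMeasure (Prod.mk θ ⁻¹' t i) := fun i =>
            measurable_measure_prodMk_left (htm i)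
          rw [lintegral_finsetSum _ fun S _ =>
            (Finset.measurable_sum _ fun i _ => hm i).const_mul _]
          refine Finset.sum_congr rfl fun S _ => ?_
          rw [lintegral_const_mul _ (Finset.measurable_sum _ fun i _ => hm i),
            lintegral_finsetSum _ fun i _ => hm i]
          simp_rw [Measure.prod_apply (htm _)]
      _ ≤ ∑ S ∈ 𝒮, ENNReal.ofReal (a S ^ 2) * ENNReal.ofReal (k * δ) := by
          refine Finset.sum_le_sum fun S hS => ?_
          gcongr
          refine (Finset.sum_le_sum fun i _ => ht i).trans (le_of_eq ?_)
          rw [Finset.sum_const, h𝒮 S hS, nsmul_eq_mul, ENNReal.ofReal_mul (Nat.cast_nonneg k),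
            ENNReal.ofReal_natCast]
      _ = ENNReal.ofReal (k * δ * ∑ S ∈ 𝒮, a S ^ 2) := by
          rw [← Finset.sum_mul, ← ENNReal.ofReal_sum_of_nonneg fun S _ => sq_nonneg _, mul_comm,
            ← ENNReal.ofReal_mul (by positivity)]
  exact (ENNReal.ofReal_le_ofReal_iff
    (mul_nonneg (by positivity) (Finset.sum_nonneg fun S _ => sq_nonneg _))).1 hint

end RandomisedStrategy

/-! ### Approximation of finitary functions -/

/-- Every real function of finitely many bits is a linear combination of Walsh characters. -/
lemma exists_eq_sum_walsh (s : Finset ℕ) {p : Cube → ℝ} (hp : DependsOn p (s : Set ℕ)) :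
    ∃ a : Finset ℕ → ℝ, ∀ ω, p ω = ∑ S ∈ s.powerset, a S * walsh S ω := by
  induction s using Finset.induction_on generalizing p with
  | empty =>
    refine ⟨fun _ => p 1, fun ω => ?_⟩
    have : p ω = p 1 := hp (by simp)
    simp [this]
  | insert i s hi ih =>
    have hu : ∀ u : ℤˣ, DependsOn (fun ω => p (Function.update ω i u)) (s : Set ℕ) := by
      intro u x y hxy
      refine hp fun j hj => ?_
      by_cases h : j = i
      · subst h; simp
      · have : j ∈ s := by simpa [h] using hj
        simp [h, hxy j this]
    have h0 : DependsOn (fun ω => (p (Function.update ω i 1) + p (Function.update ω i (-1))) / 2)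
        (s : Set ℕ) := fun x y hxy => by
      have h1 := hu 1 hxy
      have h2 := hu (-1) hxy
      simp only at h1 h2 ⊢
      rw [h1, h2]
    have h1 : DependsOn (fun ω => (p (Function.update ω i 1) - p (Function.update ω i (-1))) / 2)
        (s : Set ℕ) := fun x y hxy => by
      have h1 := hu 1 hxy
      have h2 := hu (-1) hxy
      simp only at h1 h2 ⊢
      rw [h1, h2]
    obtain ⟨b, hb⟩ := ih h0
    obtain ⟨c, hc⟩ := ih h1
    refine ⟨fun S => if i ∈ S then c (S.erase i) else b S, fun ω => ?_⟩
    have hnot : ∀ t ∈ s.powerset, i ∉ t := fun t ht h => hi (Finset.mem_powerset.1 ht h)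
    rw [Finset.sum_powerset_insert hi]
    have e1 : ∑ t ∈ s.powerset, (if i ∈ t then c (t.erase i) else b t) * walsh t ω
        = ∑ t ∈ s.powerset, b t * walsh t ω :=
      Finset.sum_congr rfl fun t ht => by rw [if_neg (hnot t ht)]
    have e2 : ∑ t ∈ s.powerset, (if i ∈ insert i t then c ((insert i t).erase i)
          else b (insert i t)) * walsh (insert i t) ω
        = ((ω i : ℤ) : ℝ) * ∑ t ∈ s.powerset, c t * walsh t ω := by
      rw [Finset.mul_sum]
      refine Finset.sum_congr rfl fun t ht => ?_
      rw [if_pos (Finset.mem_insert_self i t), Finset.erase_insert (hnot t ht),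
        walsh_insert (hnot t ht)]
      ring
    rw [e1, e2, ← hb, ← hc]
    rcases Int.units_eq_one_or (ω i) with h | h
    · have : Function.update ω i 1 = ω := by rw [← h, Function.update_eq_self]
      rw [this, h]
      push_cast
      ring
    · have : Function.update ω i (-1) = ω := by rw [← h, Function.update_eq_self]
      rw [this, h]
      push_cast
      ring

/-- The value that `f` takes almost everywhere on the cylinder of the inputs with the same first
`n` bits as `ω`, if there is such a value, and an arbitrary one otherwise. -/
def approx (f : BoolFun) (n : ℕ) (ω : Cube) : ℤˣ :=
  Classical.epsilon fun c => ∀ᵐ ω' ∂cubeMeasure, (∀ i ∈ Finset.range n, ω' i = ω i) → f ω' = c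

lemma dependsOn_approx (f : BoolFun) (n : ℕ) : DependsOn (approx f n) (Finset.range n : Set ℕ) := by
  intro x y hxy
  have : ∀ ω' : Cube, (∀ i ∈ Finset.range n, ω' i = x i) ↔ ∀ i ∈ Finset.range n, ω' i = y i :=
    fun ω' => forall₂_congr fun i hi => by rw [hxy i hi]
  simp only [approx, this]

lemma exists_approx_eq_sum_walsh (f : BoolFun) (n : ℕ) : ∃ a : Finset ℕ → ℝ, ∀ ω,
    ((approx f n ω : ℤ) : ℝ) = ∑ S ∈ (Finset.range n).powerset, a S * walsh S ω :=
  exists_eq_sum_walsh (Finset.range n) (p := fun ω => ((approx f n ω : ℤ) : ℝ))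
    fun x y hxy => by simp only [dependsOn_approx f n hxy]

lemma measurable_approx (f : BoolFun) (n : ℕ) :
    Measurable fun ω => ((approx f n ω : ℤ) : ℝ) := by
  obtain ⟨a, ha⟩ := exists_approx_eq_sum_walsh f n
  simp_rw [ha]
  exact Finset.measurable_sum _ fun S _ => (measurable_walsh S).const_mul _

lemma IsFinitary.ae_eventually_approx_eq {f : BoolFun} (hf : IsFinitary f) :
    ∀ᵐ ω ∂cubeMeasure, ∀ᶠ n in atTop, approx f n ω = f ω := by
  filter_upwards [hf, ae_eq_of_ae_cylinder f] with ω ⟨W, hW⟩ hω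
  obtain ⟨N, hN⟩ := W.exists_nat_subset_range
  filter_upwards [eventually_ge_atTop N] with n hn
  have hex : ∃ c, ∀ᵐ ω' ∂cubeMeasure, (∀ i ∈ Finset.range n, ω' i = ω i) → f ω' = c := by
    refine ⟨f ω, ?_⟩
    filter_upwards [hW] with ω' hω' hag
    exact hω' fun i hi => hag i (Finset.range_mono hn (hN hi))
  exact (hω _ _ (Classical.epsilon_spec hex)).symm

lemma IsFinitary.ae_tendsto_approx {f : BoolFun} (hf : IsFinitary f) :
    ∀ᵐ ω ∂cubeMeasure,
      Tendsto (fun n => ((approx f n ω : ℤ) : ℝ)) atTop (𝓝 ((f ω : ℤ) : ℝ)) := by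
  filter_upwards [hf.ae_eventually_approx_eq] with ω hω
  exact tendsto_const_nhds.congr' (hω.mono fun n hn => by simp only [hn])

lemma IsFinitary.aestronglyMeasurable {f : BoolFun} (hf : IsFinitary f) :
    AEStronglyMeasurable (fun ω => ((f ω : ℤ) : ℝ)) cubeMeasure :=
  aestronglyMeasurable_of_tendsto_ae atTop
    (fun n => (measurable_approx f n).aestronglyMeasurable) hf.ae_tendsto_approx

lemma IsFinitary.tendsto_mean_approx {f : BoolFun} (hf : IsFinitary f) :
    Tendsto (fun n => mean (approx f n)) atTop (𝓝 (mean f)) :=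
  tendsto_integral_of_dominated_convergence (fun _ => 1)
    (fun n => (measurable_approx f n).aestronglyMeasurable) (integrable_const _)
    (fun _ => ae_of_all _ fun _ => (abs_units_real _).le) hf.ae_tendsto_approx

lemma IsFinitary.tendsto_integral_sq_approx_sub {f : BoolFun} (hf : IsFinitary f) :
    Tendsto (fun n => ∫ ω, (((approx f n ω : ℤ) : ℝ) - ((f ω : ℤ) : ℝ)) ^ 2 ∂cubeMeasure)
      atTop (𝓝 0) := by
  have h := tendsto_integral_of_dominated_convergence (μ := cubeMeasure)
    (F := fun n ω => (((approx f n ω : ℤ) : ℝ) - ((f ω : ℤ) : ℝ)) ^ 2) (f := fun _ => 0)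
    (fun _ => 4)
    (fun n => ((measurable_approx f n).aestronglyMeasurable.sub hf.aestronglyMeasurable).pow 2)
    (integrable_const _)
    (fun n => ae_of_all _ fun ω => by
      rcases Int.units_eq_one_or (approx f n ω) with h1 | h1 <;>
      rcases Int.units_eq_one_or (f ω) with h2 | h2 <;> norm_num [h1, h2])
    (by
      filter_upwards [hf.ae_tendsto_approx] with ω hω
      simpa using (hω.sub_const ((f ω : ℤ) : ℝ)).pow 2)
  simpa using h

/-! ### Noise and Walsh characters -/

instance (ε : unitInterval) : IsProbabilityMeasure (selectorMeasure ε) := by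
  unfold selectorMeasure; infer_instance

/-- The joint law of the input, the fresh bits and the selectors. -/
abbrev noiseMeasure (ε : unitInterval) : Measure (Cube × Cube × (ℕ → Bool)) :=
  cubeMeasure.prod (cubeMeasure.prod (selectorMeasure ε))

lemma measurable_noised {α : Type*} [MeasurableSpace α] {u v : α → Cube} {X : α → ℕ → Bool}
    (hu : Measurable u) (hv : Measurable v) (hX : Measurable X) :
    Measurable fun p => noised (u p) (v p) (X p) := by
  refine measurable_pi_lambda _ fun i => Measurable.ite ?_ ?_ ?_
  · exact ((measurable_pi_apply i).comp hX) (MeasurableSet.of_discrete (s := {true}))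
  · exact (measurable_pi_apply i).comp hu
  · exact (measurable_pi_apply i).comp hv

lemma map_noised (X : ℕ → Bool) :
    (cubeMeasure.prod cubeMeasure).map (fun q : Cube × Cube => noised q.1 q.2 X) = cubeMeasure := by
  refine Measure.eq_infinitePi _ fun s t ht => ?_
  rw [Measure.map_apply (measurable_noised measurable_fst measurable_snd measurable_const)
    (.pi s.countable_toSet fun _ _ => ht _)]
  have e : (fun q : Cube × Cube => noised q.1 q.2 X) ⁻¹' (Set.pi s t)
      = (Set.pi s fun i => if X i then t i else Set.univ) ×ˢ
        (Set.pi s fun i => if X i then Set.univ else t i) := by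
    ext q
    simp only [Set.mem_preimage, Set.mem_pi, Set.mem_prod, noised, ← forall₂_and]
    refine forall₂_congr fun i _ => ?_
    cases X i <;> simp
  rw [e, Measure.prod_prod, cubeMeasure, Measure.infinitePi_pi, Measure.infinitePi_pi,
    ← Finset.prod_mul_distrib]
  · refine Finset.prod_congr rfl fun i _ => ?_
    cases X i <;> simp
  · intro i _
    split_ifs
    exacts [.univ, ht i]
  · intro i _
    split_ifs
    exacts [ht i, .univ]

lemma measurePreserving_noised (ε : unitInterval) :
    MeasurePreserving (fun p : Cube × Cube × (ℕ → Bool) => noised p.1 p.2.1 p.2.2)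
      (noiseMeasure ε) cubeMeasure := by
  have h1 := (measurePreserving_prodAssoc cubeMeasure cubeMeasure (selectorMeasure ε)).symm
  have h2 := Measure.measurePreserving_swap (μ := cubeMeasure.prod cubeMeasure)
    (ν := selectorMeasure ε)
  have h3 := (MeasurePreserving.id (selectorMeasure ε)).skew_product
    (μc := cubeMeasure.prod cubeMeasure) (μd := cubeMeasure)
    (g := fun X (q : Cube × Cube) => noised q.1 q.2 X)
    (measurable_noised (measurable_fst.comp measurable_snd) (measurable_snd.comp measurable_snd)
      measurable_fst)
    (ae_of_all _ map_noised)
  exact measurePreserving_snd.comp (h3.comp (h2.comp h1))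

lemma noised_flip_flip (i : ℕ) (ω ω' : Cube) (X : ℕ → Bool) :
    noised (flip i ω) (flip i ω') X = flip i (noised ω ω' X) := by
  funext j
  by_cases h : j = i
  · subst h
    simp only [noised, flip_self]
    split_ifs <;> rfl
  · simp only [noised, flip_of_ne h]

lemma noised_flip_of_rerandomise {i : ℕ} {X : ℕ → Bool} (h : X i = false) (ω ω' : Cube) :
    noised ω (flip i ω') X = flip i (noised ω ω' X) := by
  funext j
  by_cases hj : j = i
  · subst hj; simp [noised, h, flip_self]
  · simp only [noised, flip_of_ne hj]

lemma measurable_walsh_noised (S : Finset ℕ) :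
    Measurable fun p : Cube × Cube × (ℕ → Bool) => walsh S (noised p.1 p.2.1 p.2.2) :=
  (measurable_walsh S).comp (measurable_noised measurable_fst (measurable_fst.comp measurable_snd)
    (measurable_snd.comp measurable_snd))

lemma integrable_walsh_mul_walsh_noised (ε : unitInterval) (S T : Finset ℕ) :
    Integrable (fun p : Cube × Cube × (ℕ → Bool) =>
      walsh S p.1 * walsh T (noised p.1 p.2.1 p.2.2)) (noiseMeasure ε) :=
  .of_bound (((measurable_walsh S).comp measurable_fst).mul
    (measurable_walsh_noised T)).aestronglyMeasurable 1
    (ae_of_all _ fun p => by rw [Real.norm_eq_abs, abs_mul, abs_walsh, abs_walsh, one_mul])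

lemma integral_walsh_mul_walsh_noised_of_ne (ε : unitInterval) {S T : Finset ℕ} (h : S ≠ T) :
    ∫ p, walsh S p.1 * walsh T (noised p.1 p.2.1 p.2.2) ∂noiseMeasure ε = 0 := by
  obtain ⟨i, hi⟩ := exists_mem_xor h
  refine integral_eq_zero_of_comp_eq_neg
    (T := Prod.map (flip i) (Prod.map (flip i) id)) ?_ ?_ (ae_of_all _ fun p => ?_)
  · exact (measurePreserving_flip i).prod ((measurePreserving_flip i).prod (.id _))
  · exact (flip_involutive i).prodMap ((flip_involutive i).prodMap fun _ => rfl)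
  · simp only [Prod.map_fst, Prod.map_snd, id_eq, noised_flip_flip]
    rcases hi with ⟨hS, hT⟩ | ⟨hT, hS⟩ <;>
      simp [walsh_flip_of_mem, walsh_flip_of_notMem, hS, hT]

/-- The event that no bit of `U` is rerandomised. -/
def keepSet (U : Finset ℕ) : Set (Cube × Cube × (ℕ → Bool)) := {p | ∀ i ∈ U, p.2.2 i = true}

lemma measurableSet_selector (U : Finset ℕ) :
    MeasurableSet {X : ℕ → Bool | ∀ i ∈ U, X i = true} :=
  MeasurableSet.pi (t := fun _ => {true}) U.countable_toSet fun _ _ => .of_discrete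

lemma measurableSet_keepSet (U : Finset ℕ) : MeasurableSet (keepSet U) :=
  (measurable_snd.comp measurable_snd) (measurableSet_selector U)

lemma noiseMeasure_keepSet (ε : unitInterval) (U : Finset ℕ) :
    (noiseMeasure ε).real (keepSet U) = (1 - (ε : ℝ)) ^ U.card := by
  have h : MeasurePreserving (fun p : Cube × Cube × (ℕ → Bool) => p.2.2) (noiseMeasure ε)
      (selectorMeasure ε) := measurePreserving_snd.comp measurePreserving_snd
  have h1 : noiseMeasure ε (keepSet U) = selectorMeasure ε {X | ∀ i ∈ U, X i = true} :=
    h.measure_preimage (measurableSet_selector U).nullMeasurableSet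
  have h2 : selectorMeasure ε {X | ∀ i ∈ U, X i = true}
      = ∏ i ∈ U, bernoulliMeasure true false (unitInterval.symm ε) {true} :=
    Measure.infinitePi_pi (t := fun _ => {true}) _ fun _ _ => .of_discrete
  have h3 : (bernoulliMeasure true false (unitInterval.symm ε)).real {true} = 1 - (ε : ℝ) := by
    rw [bernoulliMeasure_real_apply_of_mem_of_notMem _ .of_discrete (by simp) (by simp)]
    simp
  rw [measureReal_def, h1, h2, Finset.prod_const, ENNReal.toReal_pow, ← measureReal_def, h3]

/-- A rerandomised bit of `S` averages `χ_S(ω) χ_S(ω^ε)` to zero; what is left is the event that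
no bit of `S` is rerandomised, on which the product is `1`. -/
lemma integral_walsh_mul_walsh_noised_self (ε : unitInterval) (S : Finset ℕ) :
    ∫ p, walsh S p.1 * walsh S (noised p.1 p.2.1 p.2.2) ∂noiseMeasure ε
      = (1 - (ε : ℝ)) ^ S.card := by
  set g : Cube × Cube × (ℕ → Bool) → ℝ :=
    fun p => walsh S p.1 * walsh S (noised p.1 p.2.1 p.2.2) with hg
  have hgi : Integrable g (noiseMeasure ε) := integrable_walsh_mul_walsh_noised ε S S
  have key : ∀ U ⊆ S, ∫ p, g p ∂noiseMeasure ε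
      = ∫ p, (keepSet U).indicator g p ∂noiseMeasure ε := by
    intro U
    induction U using Finset.induction_on with
    | empty => intro _; simp [keepSet]
    | insert i U hi ih =>
      intro hU
      rw [ih ((Finset.subset_insert i U).trans hU), ← sub_eq_zero,
        ← integral_sub (hgi.indicator (measurableSet_keepSet _))
          (hgi.indicator (measurableSet_keepSet _))]
      refine integral_eq_zero_of_comp_eq_neg
        (T := Prod.map id (Prod.map (flip i) id)) ?_ ?_ (ae_of_all _ fun p => ?_)
      · exact (MeasurePreserving.id _).prod ((measurePreserving_flip i).prod (.id _))
      · exact Function.Involutive.prodMap (fun _ => rfl)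
          ((flip_involutive i).prodMap fun _ => rfl)
      · obtain ⟨ω, ω', X⟩ := p
        have hiS : i ∈ S := hU (Finset.mem_insert_self i U)
        obtain ⟨P, hP⟩ : ∃ P : Prop, (∀ j ∈ U, X j = true) = P := ⟨_, rfl⟩
        have hU1 : ∀ η, ((ω, η, X) ∈ keepSet U) = P := fun _ => hP
        have hU2 : ∀ η, ((ω, η, X) ∈ keepSet (insert i U)) = (X i = true ∧ P) := fun η => by
          rw [← hP]
          simp [keepSet]
        classical
        simp only [Prod.map_apply, id_eq, Set.indicator_apply, hU1, hU2]
        by_cases hp : P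
        · cases h : X i with
          | true => simp [hp]
          | false =>
            have hneg : g (ω, flip i ω', X) = -g (ω, ω', X) := by
              simp only [hg]
              rw [noised_flip_of_rerandomise h, walsh_flip_of_mem hiS, mul_neg]
            simp [hp, hneg]
        · simp [hp]
  have hone : ∀ p, (keepSet S).indicator g p = (keepSet S).indicator 1 p := fun p => by
    by_cases hp : p ∈ keepSet S
    · rw [Set.indicator_of_mem hp, Set.indicator_of_mem hp, hg]
      have : walsh S (noised p.1 p.2.1 p.2.2) = walsh S p.1 :=
        walsh_congr fun i hi => by simp [noised, hp i hi]
      simp only [this, walsh_mul_self, Pi.one_apply]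
    · rw [Set.indicator_of_notMem hp, Set.indicator_of_notMem hp]
  rw [key S subset_rfl]
  simp_rw [hone]
  rw [integral_indicator_one (measurableSet_keepSet S), noiseMeasure_keepSet]

/-! ### Noise correlation -/

/-- The spectral formula for the noise correlation, for a function of finitely many bits. -/
lemma noiseCorrelation_eq_sum {p : BoolFun} {𝒮 : Finset (Finset ℕ)} {a : Finset ℕ → ℝ}
    (hp : ∀ ω, ((p ω : ℤ) : ℝ) = ∑ S ∈ 𝒮, a S * walsh S ω) (ε : unitInterval) :
    noiseCorrelation p ε = ∑ S ∈ 𝒮, a S ^ 2 * (1 - (ε : ℝ)) ^ S.card := by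
  have h1 : ∀ q : Cube × Cube × (ℕ → Bool),
      (∑ S ∈ 𝒮, a S * walsh S q.1) * (∑ T ∈ 𝒮, a T * walsh T (noised q.1 q.2.1 q.2.2))
      = ∑ S ∈ 𝒮, ∑ T ∈ 𝒮,
        (a S * a T) * (walsh S q.1 * walsh T (noised q.1 q.2.1 q.2.2)) := fun q => by
    rw [Finset.sum_mul_sum]
    exact Finset.sum_congr rfl fun _ _ => Finset.sum_congr rfl fun _ _ => by ring
  rw [noiseCorrelation]
  simp_rw [hp, h1]
  rw [integral_finsetSum _ fun S _ => integrable_finsetSum _ fun T _ =>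
    (integrable_walsh_mul_walsh_noised ε S T).const_mul _]
  refine Finset.sum_congr rfl fun S hS => ?_
  rw [integral_finsetSum _ fun T _ => (integrable_walsh_mul_walsh_noised ε S T).const_mul _]
  simp_rw [integral_const_mul]
  rw [Finset.sum_eq_single S]
  · rw [integral_walsh_mul_walsh_noised_self, sq]
  · intro T _ hne
    rw [integral_walsh_mul_walsh_noised_of_ne ε hne.symm, mul_zero]
  · exact fun hn => absurd hS hn

lemma mean_eq_coeff_empty {p : BoolFun} {𝒮 : Finset (Finset ℕ)} (h𝒮 : ∅ ∈ 𝒮) {a : Finset ℕ → ℝ}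
    (hp : ∀ ω, ((p ω : ℤ) : ℝ) = ∑ S ∈ 𝒮, a S * walsh S ω) : mean p = a ∅ := by
  rw [mean]
  simp_rw [hp]
  rw [integral_finsetSum _ fun S _ => (integrable_walsh S).const_mul _]
  have h : ∀ S, ∫ ω, a S * walsh S ω ∂cubeMeasure = if S = ∅ then a S else 0 := fun S => by
    have := integral_walsh_mul S ∅
    simp only [walsh_empty, mul_one] at this
    rw [integral_const_mul, this]
    simp
  simp_rw [h]
  simp [h𝒮]

lemma IsFinitary.tendsto_noiseCorrelation_approx {f : BoolFun} (hf : IsFinitary f)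
    (ε : unitInterval) :
    Tendsto (fun n => noiseCorrelation (approx f n) ε) atTop (𝓝 (noiseCorrelation f ε)) := by
  refine tendsto_integral_of_dominated_convergence (fun _ => 1) (fun n => ?_)
    (integrable_const _) (fun n => ae_of_all _ fun p => ?_) ?_
  · exact (((measurable_approx f n).comp measurable_fst).mul
      ((measurable_approx f n).comp (measurePreserving_noised ε).measurable)).aestronglyMeasurable
  · rw [Real.norm_eq_abs, abs_mul, abs_units_real, abs_units_real, one_mul]
  · have h1 : ∀ᵐ p : Cube × Cube × (ℕ → Bool) ∂noiseMeasure ε, _ :=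
      (measurePreserving_fst (μ := cubeMeasure)
        (ν := cubeMeasure.prod (selectorMeasure ε))).quasiMeasurePreserving.ae hf.ae_tendsto_approx
    filter_upwards [h1,
      (measurePreserving_noised ε).quasiMeasurePreserving.ae hf.ae_tendsto_approx] with p hp1 hp2
    exact hp1.mul hp2

/-- The weight of a function of finitely many bits on the characters of degree `k`, bounded
through an algorithm for a nearby function `f`. -/
lemma sum_sq_coeff_le {f p : BoolFun} {A : RandomisedStrategy} (hA : A.IsAlgorithmFor f)
    (hfm : AEStronglyMeasurable (fun ω => ((f ω : ℤ) : ℝ)) cubeMeasure) {δ : ℝ} (hδ : 0 ≤ δ)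
    (hAδ : A.revealment ≤ ENNReal.ofReal δ) {𝒮 𝒯 : Finset (Finset ℕ)} {a : Finset ℕ → ℝ}
    (hp : ∀ ω, ((p ω : ℤ) : ℝ) = ∑ S ∈ 𝒮, a S * walsh S ω) (h𝒯 : 𝒯 ⊆ 𝒮)
    {k : ℕ} (hk : k ≠ 0) (hcard : ∀ S ∈ 𝒯, S.card = k) :
    ∑ S ∈ 𝒯, a S ^ 2
      ≤ 2 * (k * δ) + 2 * ∫ ω, (((p ω : ℤ) : ℝ) - ((f ω : ℤ) : ℝ)) ^ 2 ∂cubeMeasure := by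
  set w := ∑ S ∈ 𝒯, a S ^ 2 with hw
  set η := ∫ ω, (((p ω : ℤ) : ℝ) - ((f ω : ℤ) : ℝ)) ^ 2 ∂cubeMeasure with hη
  set g : Cube → ℝ := fun ω => ∑ S ∈ 𝒯, a S * walsh S ω with hg
  have hw0 : 0 ≤ w := Finset.sum_nonneg fun S _ => sq_nonneg _
  have hη0 : 0 ≤ η := integral_nonneg fun ω => sq_nonneg _
  have hgi : Integrable g cubeMeasure :=
    integrable_finsetSum _ fun S _ => (integrable_walsh S).const_mul _
  have hpm : AEStronglyMeasurable (fun ω => ((p ω : ℤ) : ℝ)) cubeMeasure := by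
    simp_rw [hp]
    exact (integrable_finsetSum _ fun S _ =>
      (integrable_walsh S).const_mul _).aestronglyMeasurable
  have hgg : ∫ ω, g ω ^ 2 ∂cubeMeasure = w := by
    simp_rw [sq (g _)]
    exact integral_sum_walsh_mul_sum_walsh 𝒯 𝒯 subset_rfl a
  have hg2 : Integrable (fun ω => g ω ^ 2) cubeMeasure := by
    have e : ∀ ω, g ω ^ 2 = ∑ S ∈ 𝒯, ∑ T ∈ 𝒯, (a S * a T) * (walsh S ω * walsh T ω) := fun ω => by
      rw [sq, hg, Finset.sum_mul_sum]
      exact Finset.sum_congr rfl fun _ _ => Finset.sum_congr rfl fun _ _ => by ring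
    simp_rw [e]
    exact integrable_finsetSum _ fun S _ => integrable_finsetSum _ fun T _ =>
      (integrable_walsh_mul S T).const_mul _
  have hpg : ∫ ω, ((p ω : ℤ) : ℝ) * g ω ∂cubeMeasure = w := by
    simp_rw [hp]
    exact integral_sum_walsh_mul_sum_walsh 𝒮 𝒯 h𝒯 a
  have hfg : (∫ ω, ((f ω : ℤ) : ℝ) * g ω ∂cubeMeasure) ^ 2 ≤ k * δ * w :=
    hA.sq_integral_mul_sum_walsh_le hfm hδ hAδ hk hcard a
  have hdm : AEStronglyMeasurable (fun ω => ((p ω : ℤ) : ℝ) - ((f ω : ℤ) : ℝ)) cubeMeasure :=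
    hpm.sub hfm
  have hdb : ∀ ω, ‖((p ω : ℤ) : ℝ) - ((f ω : ℤ) : ℝ)‖ ≤ 2 := fun ω => by
    refine (norm_sub_le _ _).trans ?_
    rw [Real.norm_eq_abs, Real.norm_eq_abs, abs_units_real, abs_units_real]
    norm_num
  have hdi : Integrable (fun ω => ((p ω : ℤ) : ℝ) - ((f ω : ℤ) : ℝ)) cubeMeasure :=
    .of_bound hdm 2 (ae_of_all _ hdb)
  have hdg := sq_integral_mul_le (μ := cubeMeasure)
    (u := fun ω => ((p ω : ℤ) : ℝ) - ((f ω : ℤ) : ℝ)) (v := g)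
    (by
      simp_rw [sq]
      exact hdi.bdd_mul hdm (ae_of_all _ hdb))
    hg2 (hgi.bdd_mul hdm (ae_of_all _ hdb))
  rw [hgg] at hdg
  have hsum : w = ∫ ω, ((f ω : ℤ) : ℝ) * g ω ∂cubeMeasure
      + ∫ ω, (((p ω : ℤ) : ℝ) - ((f ω : ℤ) : ℝ)) * g ω ∂cubeMeasure := by
    rw [← integral_add (hgi.bdd_mul hfm (ae_of_all _ fun ω => (abs_units_real _).le))
      (hgi.bdd_mul hdm (ae_of_all _ hdb)), ← hpg]
    exact integral_congr_ae (ae_of_all _ fun ω => by ring)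
  set x := ∫ ω, ((f ω : ℤ) : ℝ) * g ω ∂cubeMeasure
  set y := ∫ ω, (((p ω : ℤ) : ℝ) - ((f ω : ℤ) : ℝ)) * g ω ∂cubeMeasure
  have hq : w * w ≤ (2 * (k * δ) + 2 * η) * w := by
    have : w * w = (x + y) ^ 2 := by rw [sq, ← hsum]
    nlinarith [sq_nonneg (x - y)]
  rcases hw0.eq_or_lt with h0 | h0
  · rw [← h0]
    positivity
  · exact le_of_mul_le_mul_right hq h0

/-- The covariance of `p(ω)` and `p(ω^ε)` is at most the weight on the degrees `1, …, K`, plus the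
exponentially small contribution of the higher degrees. -/
lemma noiseCorrelation_sub_le {p : BoolFun} {s : Finset ℕ} {a : Finset ℕ → ℝ}
    (hp : ∀ ω, ((p ω : ℤ) : ℝ) = ∑ S ∈ s.powerset, a S * walsh S ω) (ε : unitInterval) (K : ℕ) :
    0 ≤ noiseCorrelation p ε - mean p ^ 2 ∧
    noiseCorrelation p ε - mean p ^ 2
      ≤ ∑ k ∈ Finset.Icc 1 K, ∑ S ∈ s.powersetCard k, a S ^ 2 + (1 - (ε : ℝ)) ^ K := by
  have hρ0 : 0 ≤ 1 - (ε : ℝ) := sub_nonneg.2 ε.2.2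
  have hρ1 : 1 - (ε : ℝ) ≤ 1 := sub_le_self _ ε.2.1
  have hempty : ∅ ∈ s.powerset := Finset.empty_mem_powerset s
  have hparseval : ∑ S ∈ s.powerset, a S ^ 2 = 1 := by
    rw [← integral_sum_walsh_mul_sum_walsh s.powerset s.powerset subset_rfl a]
    simp_rw [← hp, ← sq, sq_units_real]
    simp
  have hcov : noiseCorrelation p ε - mean p ^ 2
      = ∑ S ∈ s.powerset.erase ∅, a S ^ 2 * (1 - (ε : ℝ)) ^ S.card := by
    rw [noiseCorrelation_eq_sum hp, mean_eq_coeff_empty hempty hp,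
      ← Finset.add_sum_erase _ _ hempty]
    simp
  rw [hcov]
  refine ⟨Finset.sum_nonneg fun S _ => by positivity, ?_⟩
  rw [← Finset.sum_filter_add_sum_filter_not (s.powerset.erase ∅) (fun S => S.card ≤ K)]
  refine add_le_add ?_ ?_
  · have hmaps : ∀ S ∈ (s.powerset.erase ∅).filter (fun S => S.card ≤ K),
        S.card ∈ Finset.Icc 1 K := fun S hS => by
      simp only [Finset.mem_filter, Finset.mem_erase] at hS
      exact Finset.mem_Icc.2 ⟨Finset.card_pos.2 (Finset.nonempty_iff_ne_empty.2 hS.1.1), hS.2⟩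
    rw [← Finset.sum_fiberwise_of_maps_to hmaps]
    refine Finset.sum_le_sum fun k _ => ?_
    refine (Finset.sum_le_sum fun S _ =>
      mul_le_of_le_one_right (sq_nonneg (a S)) (pow_le_one₀ hρ0 hρ1)).trans ?_
    refine Finset.sum_le_sum_of_subset_of_nonneg (fun S hS => ?_) fun S _ _ => sq_nonneg _
    simp only [Finset.mem_filter, Finset.mem_erase, Finset.mem_powerset] at hS
    exact Finset.mem_powersetCard.2 ⟨hS.1.1.2, hS.2⟩
  · calc ∑ S ∈ (s.powerset.erase ∅).filter (fun S => ¬S.card ≤ K),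
          a S ^ 2 * (1 - (ε : ℝ)) ^ S.card
        ≤ ∑ S ∈ (s.powerset.erase ∅).filter (fun S => ¬S.card ≤ K),
          a S ^ 2 * (1 - (ε : ℝ)) ^ K := by
          refine Finset.sum_le_sum fun S hS => ?_
          have := (Finset.mem_filter.1 hS).2
          exact mul_le_mul_of_nonneg_left (pow_le_pow_of_le_one hρ0 hρ1 (by omega)) (sq_nonneg _)
      _ ≤ ∑ S ∈ s.powerset, a S ^ 2 * (1 - (ε : ℝ)) ^ K :=
          Finset.sum_le_sum_of_subset_of_nonneg
            ((Finset.filter_subset _ _).trans (Finset.erase_subset _ _))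
            fun S _ _ => by positivity
      _ = (1 - (ε : ℝ)) ^ K := by rw [← Finset.sum_mul, hparseval, one_mul]

/-- A quantitative form of noise sensitivity, for one function and one algorithm. -/
theorem noiseCorrelation_sub_le_of_revealment {f : BoolFun} (hf : IsFinitary f)
    {A : RandomisedStrategy} (hA : A.IsAlgorithmFor f) {δ : ℝ} (hδ : 0 ≤ δ)
    (hAδ : A.revealment ≤ ENNReal.ofReal δ) (ε : unitInterval) (K : ℕ) :
    0 ≤ noiseCorrelation f ε - mean f ^ 2 ∧
    noiseCorrelation f ε - mean f ^ 2
      ≤ ∑ k ∈ Finset.Icc 1 K, 2 * (k * δ) + (1 - (ε : ℝ)) ^ K := by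
  have hlim := (hf.tendsto_noiseCorrelation_approx ε).sub (hf.tendsto_mean_approx.pow 2)
  have hη := hf.tendsto_integral_sq_approx_sub
  choose a ha using exists_approx_eq_sum_walsh f
  have hb := fun n => noiseCorrelation_sub_le (ha n) ε K
  refine ⟨ge_of_tendsto' hlim fun n => (hb n).1, ?_⟩
  have hrhs : Tendsto (fun n => ∑ k ∈ Finset.Icc 1 K, (2 * (k * δ)
        + 2 * ∫ ω, (((approx f n ω : ℤ) : ℝ) - ((f ω : ℤ) : ℝ)) ^ 2 ∂cubeMeasure)
        + (1 - (ε : ℝ)) ^ K) atTop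
      (𝓝 (∑ k ∈ Finset.Icc 1 K, (2 * (k * δ) + 2 * 0) + (1 - (ε : ℝ)) ^ K)) :=
    (tendsto_finsetSum _ fun k _ => (hη.const_mul 2).const_add _).add_const _
  simp only [mul_zero, add_zero] at hrhs
  refine le_of_tendsto_of_tendsto' hlim hrhs fun n => (hb n).2.trans ?_
  gcongr with k hk
  exact sum_sq_coeff_le hA hf.aestronglyMeasurable hδ hAδ (ha n)
    (fun S hS => Finset.mem_powerset.2 (Finset.mem_powersetCard.1 hS).1)
    (Nat.one_le_iff_ne_zero.1 (Finset.mem_Icc.1 hk).1)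
    fun S hS => (Finset.mem_powersetCard.1 hS).2

end BooleanNoise
end

theorem mainTheorem9 (f : ℕ → BooleanNoise.BoolFun)
    (hf : ∀ n, BooleanNoise.IsFinitary (f n))
    (hδ : Tendsto (fun n => BooleanNoise.revealment (f n)) atTop (𝓝 0)) :
    BooleanNoise.NoiseSensitive f := by
  intro ε hε
  refine Metric.tendsto_atTop'.2 fun e he => ?_
  have hρ0 : 0 ≤ 1 - (ε : ℝ) := sub_nonneg.2 ε.2.2
  have hρ1 : 1 - (ε : ℝ) < 1 := sub_lt_self _ hε
  obtain ⟨K, hK⟩ := exists_pow_lt_of_lt_one (half_pos he) hρ1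
  -- The degree `K` makes the tail small; `δ` is then chosen against the degrees up to `K`.
  set C : ℝ := ∑ k ∈ Finset.Icc 1 K, 2 * (k : ℝ) with hC
  have hC0 : 0 ≤ C := Finset.sum_nonneg fun k _ => by positivity
  set δ : ℝ := e / 2 / (C + 1) with hδdef
  have hδ0 : 0 < δ := by positivity
  have hCδ : C * δ < e / 2 := by
    have h1 : (C + 1) * δ = e / 2 := by rw [hδdef]; field_simp
    linarith
  obtain ⟨N, hN⟩ := eventually_atTop.1 (hδ.eventually_lt_const (ENNReal.ofReal_pos.2 hδ0))
  refine ⟨N, fun n hn => ?_⟩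
  obtain ⟨A, hA⟩ := iInf_lt_iff.1 (hN n hn.le)
  obtain ⟨hAf, hAδ⟩ := iInf_lt_iff.1 hA
  obtain ⟨h0, h1⟩ :=
    BooleanNoise.noiseCorrelation_sub_le_of_revealment (hf n) hAf hδ0.le hAδ.le ε K
  have h2 : ∑ k ∈ Finset.Icc 1 K, 2 * ((k : ℝ) * δ) = C * δ := by
    rw [hC, Finset.sum_mul]
    exact Finset.sum_congr rfl fun k _ => by ring
  rw [Real.dist_eq, sub_zero, abs_of_nonneg h0]
  linarith
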